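/- Let $Q\in\mathbb{R}^{n\times n}$, $c\in\mathbb{R}^n$, $A\in\mathbb{R}^{m\times n}$ with rows $A_{i,*}$, $b\in\mathbb{R}^m$ and $B\subseteq\{1,\dots,n\}$. Consider the mixed-binary quadratic program $$\text{(MBQP)}\qquad \min_{x\in\mathbb{R}^n}\; x^\top Qx+2c^\top x\quad\text{s.t. } Ax=b,\; x\ge 0,\; x_j\in\{0,1\}\ (j\in B).$$ For $S\in\mathbb{R}^{n\times n}$, $u\in\mathbb{R}^n$, $d\in\mathbb{R}$ write $[S,u,d]=\begin{pmatrix}S&u\\u^\top&d\end{pmatrix}$, and let $\langle M,N\rangle=\mathrm{Tr}(M^\top N)$. Let $\mathcal{C}^*_{n+1}$ be the cone of completely positive matrices (finite sums $\sum_k v^{(k)}(v^{(k)})^\top$ with $v^{(k)}\in\mathbb{R}^{n+1}_{\ge 0}$) and $\mathcal{C}_{n+1}$ the cone of copositive matrices ($v^\top Mv\ge 0$ for all $v\in\mathbb{R}^{n+1}_{\ge0}$). Burer's completely positive program is $$\text{(CPP)}\qquad \min_{X\in\mathbb{R}^{n\times n},\,x\in\mathbb{R}^n}\ \langle [Q,c,0],[X,x,1]\rangle$$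 subject to $\langle[0,\tfrac12A_{i,*}^\top,0],[X,x,1]\rangle=b_i$ and $\langle[A_{i,*}^\top A_{i,*},0,0],[X,x,1]\rangle=b_i^2$ for $i=1,\dots,m$, $\langle[-e_je_j^\top,\tfrac12e_j,0],[X,x,1]\rangle=0$ for $j\in B$, and $[X,x,1]\in\mathcal{C}^*_{n+1}$. Its dual copositive program is $$\text{(COP)}\qquad \sup_{\mu^{(\mathrm{lin})},\,\mu^{(\mathrm{quad})}\in\mathbb{R}^m,\ \lambda\in\mathbb{R}^B,\ \gamma\in\mathbb{R}}\ \gamma+\sum_{i=1}^m\big(\mu^{(\mathrm{lin})}_ib_i+\mu^{(\mathrm{quad})}_ib_i^2\big)\quad\text{s.t. } M(\mu,\lambda,\gamma)\in\mathcal{C}_{n+1},$$ $$M(\mu,\lambda,\gamma)=[Q,c,0]-\sum_i\mu^{(\mathrm{lin})}_i[0,\tfrac12A_{i,*}^\top,0]-\sum_i\mu^{(\mathrm{quad})}_i[A_{i,*}^\top A_{i,*},0,0]-\sum_{j\in B}\lambda_j[-e_je_j^\top,\tfrac12e_j,0]-\gamma[0,0,1].$$ **Theorem (Strong Duality).** Suppose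 that (MBQP) is feasible and its feasible region is bounded. Then (CPP) attains its minimum, (COP) is feasible, and strong duality holds: the minimum of (CPP) equals the (finite) supremum of (COP). If in addition $x_j\le 1$ for every $j\in B$ and every $x\ge0$ with $Ax=b$ (the assumption under which Burer's reformulation is exact), then (MBQP) attains its minimum and its optimal value equals this common value. -/

import Mathlib

open Matrix

/-- The matrix inner product `⟨M, N⟩ = Tr(Mᵀ N)`. -/
def matInner {ι : Type*} [Fintype ι] (M N : Matrix ι ι ℝ) : ℝ :=
  (Mᵀ * N).trace

/-- The cone of completely positive matrices: finite sums of `v vᵀ` with `v` entrywise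
nonnegative. -/
def completelyPositiveCone (ι : Type*) : Set (Matrix ι ι ℝ) :=
  {X | ∃ (K : ℕ) (v : Fin K → ι → ℝ),
    (∀ k i, 0 ≤ v k i) ∧ X = ∑ k, vecMulVec (v k) (v k)}

/-- The cone of copositive matrices: `vᵀ X v ≥ 0` for every entrywise nonnegative `v`. -/
def copositiveCone (ι : Type*) [Fintype ι] : Set (Matrix ι ι ℝ) :=
  {X | ∀ v : ι → ℝ, (∀ i, 0 ≤ v i) → 0 ≤ v ⬝ᵥ (X *ᵥ v)}

/-- The bordered matrix with blocks `[[S, u], [uᵀ, d]]`, of size `n + 1`. -/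
def borderedMatrix {n : ℕ} (S : Matrix (Fin n) (Fin n) ℝ) (u : Fin n → ℝ) (d : ℝ) :
    Matrix (Fin n ⊕ Unit) (Fin n ⊕ Unit) ℝ :=
  fromBlocks S (of fun i _ => u i) (of fun _ j => u j) (of fun _ _ => d)

/-- The data of a mixed-binary quadratic program: minimize `xᵀ Q x + 2 cᵀ x` subject to
`A x = b`, `x ≥ 0` and `x j ∈ {0, 1}` for `j ∈ B`. -/
structure MBQP (n m : ℕ) where
  Q : Matrix (Fin n) (Fin n) ℝ
  c : Fin n → ℝ
  A : Matrix (Fin m) (Fin n) ℝ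
  b : Fin m → ℝ
  B : Finset (Fin n)

namespace MBQP

variable {n m : ℕ} (P : MBQP n m)

/-- The polyhedron `{x | A x = b, x ≥ 0}`, without the binary constraints. -/
def polyhedron : Set (Fin n → ℝ) :=
  {x | P.A *ᵥ x = P.b ∧ ∀ i, 0 ≤ x i}

/-- The feasible region of the mixed-binary quadratic program. -/
def feasibleRegion : Set (Fin n → ℝ) :=
  {x | P.A *ᵥ x = P.b ∧ (∀ i, 0 ≤ x i) ∧ ∀ j ∈ P.B, x j = 0 ∨ x j = 1}

/-- The objective `xᵀ Q x + 2 cᵀ x`. -/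
def objective (x : Fin n → ℝ) : ℝ :=
  x ⬝ᵥ (P.Q *ᵥ x) + 2 * (P.c ⬝ᵥ x)

/-- The cost matrix `[[Q, c], [cᵀ, 0]]`. -/
def costMatrix : Matrix (Fin n ⊕ Unit) (Fin n ⊕ Unit) ℝ :=
  borderedMatrix P.Q P.c 0

/-- The matrix `[[0, ½ Aᵢᵀ], [½ Aᵢ, 0]]` of the `i`-th linear constraint. -/
noncomputable def linMatrix (i : Fin m) : Matrix (Fin n ⊕ Unit) (Fin n ⊕ Unit) ℝ :=
  borderedMatrix 0 ((1 / 2 : ℝ) • P.A i) 0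

/-- The matrix `[[Aᵢᵀ Aᵢ, 0], [0, 0]]` of the `i`-th squared constraint. -/
def quadMatrix (i : Fin m) : Matrix (Fin n ⊕ Unit) (Fin n ⊕ Unit) ℝ :=
  borderedMatrix (vecMulVec (P.A i) (P.A i)) 0 0

/-- The matrix `[[-eⱼ eⱼᵀ, ½ eⱼ], [½ eⱼᵀ, 0]]` of the binary constraint on `x j`. -/
noncomputable def binMatrix (j : Fin n) : Matrix (Fin n ⊕ Unit) (Fin n ⊕ Unit) ℝ :=
  borderedMatrix (-vecMulVec (Pi.single j 1) (Pi.single j 1))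
    ((1 / 2 : ℝ) • Pi.single j 1) 0

/-- The feasible pairs `(X, x)` of the completely positive program. -/
def cppFeasible : Set (Matrix (Fin n) (Fin n) ℝ × (Fin n → ℝ)) :=
  {p | (∀ i, matInner (P.linMatrix i) (borderedMatrix p.1 p.2 1) = P.b i) ∧
    (∀ i, matInner (P.quadMatrix i) (borderedMatrix p.1 p.2 1) = P.b i ^ 2) ∧
    (∀ j ∈ P.B, matInner (binMatrix j) (borderedMatrix p.1 p.2 1) = 0) ∧
    borderedMatrix p.1 p.2 1 ∈ completelyPositiveCone (Fin n ⊕ Unit)}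

/-- The objective of the completely positive program. -/
def cppObjective (p : Matrix (Fin n) (Fin n) ℝ × (Fin n → ℝ)) : ℝ :=
  matInner P.costMatrix (borderedMatrix p.1 p.2 1)

/-- The variables of the dual copositive program: `μ^(lin)`, `μ^(quad)`, `lam` (usually written
`λ`, indexed by `B`) and `γ`. -/
structure DualVar where
  μlin : Fin m → ℝ
  μquad : Fin m → ℝ
  lam : P.B → ℝ
  γ : ℝ

/-- The matrix `M(μ, λ, γ)` of the dual copositive program. -/
noncomputable def dualMatrix (y : P.DualVar) : Matrix (Fin n ⊕ Unit) (Fin n ⊕ Unit) ℝ :=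
  P.costMatrix - ∑ i, y.μlin i • P.linMatrix i - ∑ i, y.μquad i • P.quadMatrix i
    - ∑ j : P.B, y.lam j • binMatrix (j : Fin n) - y.γ • borderedMatrix 0 0 1

/-- The feasible region of the dual copositive program. -/
def copFeasible : Set P.DualVar :=
  {y | P.dualMatrix y ∈ copositiveCone (Fin n ⊕ Unit)}

/-- The objective of the dual copositive program. -/
def copObjective (y : P.DualVar) : ℝ :=
  y.γ + ∑ i, (y.μlin i * P.b i + y.μquad i * P.b i ^ 2)

end MBQP

/-! Duality: a completely positive matrix is `∑ v vᵀ` with `v = (z, ξ)`. If all homogeneous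
constraints vanish on it, the corner gives `ξ = 0`, the squared rows give `A z = 0` and the binary
constraints give `z j = 0` on `B`. Each `z` is then a recession direction of a bounded region, so
zero. Hence the map sending a matrix to its constraint values and cost vanishes on the cone only at
the origin, and as the cone has a compact base its image is closed
(`isClosed_image_completelyPositiveCone`). Closedness gives attainment, and separation excludes a
gap (`completelyPositive_strong_duality`). Dual feasibility is contained in `IsLUB`, since the empty
set has no supremum in `ℝ`.

Exactness: for a feasible matrix each `z / ξ` with `ξ > 0` is feasible for the binary program, and
the lifted cost is the average of their objectives with weights `ξ ^ 2`
(`exists_objective_le_cppObjective`). -/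

/-! ### Convex hulls and cones of compact sets. -/

theorem isCompact_convexHull_of_isCompact {E : Type*} [NormedAddCommGroup E] [NormedSpace ℝ E]
    [FiniteDimensional ℝ E] {s : Set E} (hs : IsCompact s) : IsCompact (convexHull ℝ s) := by
  let G (k : ℕ) : (Fin k → ℝ) × (Fin k → E) → E := fun p => ∑ i, p.1 i • p.2 i
  have hG (k : ℕ) : IsCompact (G k '' (stdSimplex ℝ (Fin k) ×ˢ Set.univ.pi fun _ => s)) := by
    refine ((isCompact_stdSimplex ℝ (Fin k)).prod (isCompact_univ_pi fun _ => hs)).image ?_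
    fun_prop
  -- By Carathéodory, at most `finrank + 1` points suffice, so the hull is a finite union of compact
  -- images.
  have hU := (Finset.range (Module.finrank ℝ E + 2)).isCompact_biUnion fun k _ => hG k
  convert hU using 1
  apply Set.Subset.antisymm
  · intro x hx
    obtain ⟨κ, _, z, w, hz, hind, hw, hw1, rfl⟩ := eq_pos_convex_span_of_mem_convexHull hx
    have hcard := hind.card_le_finrank_succ
    have hle := Submodule.finrank_le (vectorSpan ℝ (Set.range z))
    have e := Fintype.equivFin κ
    simp only [Set.mem_iUnion]
    refine ⟨Fintype.card κ, Finset.mem_range.2 (by omega), (w ∘ e.symm, z ∘ e.symm),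
      ⟨⟨?_, ?_⟩, ?_⟩, ?_⟩
    · exact fun i => (hw _).le
    · simpa using (e.symm.sum_comp w).trans hw1
    · exact fun i _ => hz ⟨_, rfl⟩
    · exact e.symm.sum_comp fun i => w i • z i
  · simp only [Set.iUnion_subset_iff]
    rintro k - _ ⟨p, ⟨hp1, hp2⟩, rfl⟩
    exact (convex_convexHull ℝ s).sum_mem (fun i _ => hp1.1 i) hp1.2
      fun i _ => subset_convexHull ℝ s (hp2 i trivial)

/-- The cone generated by a compact set avoiding the origin is closed. -/
theorem isClosed_nonneg_smul {E : Type*} [NormedAddCommGroup E] [NormedSpace ℝ E]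
    {C : Set E} (hC : IsCompact C) (h0 : (0 : E) ∉ C) :
    IsClosed {x | ∃ t : ℝ, 0 ≤ t ∧ ∃ c ∈ C, x = t • c} := by
  rw [← isSeqClosed_iff_isClosed]
  intro x y hx hxy
  choose t ht c hc hxt using hx
  obtain ⟨d, hd, φ, hφ, hlim⟩ := hC.tendsto_subseq hc
  have hd0 : ‖d‖ ≠ 0 := by
    rw [norm_ne_zero_iff]
    rintro rfl
    exact h0 hd
  have hxφ := hxy.comp hφ.tendsto_atTop
  -- The multipliers are ratios of norms, so they converge because the limit `d` is nonzero.
  have htφ : Filter.Tendsto (t ∘ φ) Filter.atTop (nhds (‖y‖ / ‖d‖)) := by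
    refine (hxφ.norm.div hlim.norm hd0).congr fun n => ?_
    have hne : ‖c (φ n)‖ ≠ 0 := by
      rw [norm_ne_zero_iff]
      intro h
      exact h0 (h ▸ hc _)
    change ‖x (φ n)‖ / ‖c (φ n)‖ = t (φ n)
    rw [hxt (φ n), norm_smul, Real.norm_of_nonneg (ht _), mul_div_cancel_right₀ _ hne]
  refine ⟨_, by positivity, d, hd, tendsto_nhds_unique hxφ ((htφ.smul hlim).congr fun n => ?_)⟩
  exact (hxt (φ n)).symm

/-! ### The completely positive cone and conic duality. -/

section Cone

variable {ι : Type*}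

theorem vecMulVec_self_mem_completelyPositiveCone {v : ι → ℝ} (hv : ∀ i, 0 ≤ v i) :
    vecMulVec v v ∈ completelyPositiveCone ι :=
  ⟨1, fun _ => v, fun _ => hv, by simp⟩

theorem zero_mem_completelyPositiveCone : (0 : Matrix ι ι ℝ) ∈ completelyPositiveCone ι :=
  ⟨0, fun _ _ => 0, fun _ _ => le_rfl, by simp⟩

theorem add_mem_completelyPositiveCone {X Y : Matrix ι ι ℝ}
    (hX : X ∈ completelyPositiveCone ι) (hY : Y ∈ completelyPositiveCone ι) :
    X + Y ∈ completelyPositiveCone ι := by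
  obtain ⟨K, v, hv, rfl⟩ := hX
  obtain ⟨L, w, hw, rfl⟩ := hY
  refine ⟨K + L, Fin.append v w, fun k i => ?_, ?_⟩
  · refine Fin.addCases (fun k => ?_) (fun k => ?_) k
    · simpa using hv k i
    · simpa using hw k i
  · simp [Fin.sum_univ_add]

theorem smul_mem_completelyPositiveCone {X : Matrix ι ι ℝ} {t : ℝ} (ht : 0 ≤ t)
    (hX : X ∈ completelyPositiveCone ι) : t • X ∈ completelyPositiveCone ι := by
  obtain ⟨K, v, hv, rfl⟩ := hX
  refine ⟨K, fun k => √t • v k, fun k i => mul_nonneg t.sqrt_nonneg (hv k i), ?_⟩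
  simp [Finset.smul_sum, vecMulVec_smul, smul_vecMulVec, smul_smul, Real.mul_self_sqrt ht]

theorem convex_completelyPositiveCone : Convex ℝ (completelyPositiveCone ι) :=
  fun _ hX _ hY _ _ ha hb _ => add_mem_completelyPositiveCone
    (smul_mem_completelyPositiveCone ha hX) (smul_mem_completelyPositiveCone hb hY)

variable [Fintype ι]

/-- `⟨M, ·⟩` as a linear map. -/
def matInnerₗ (M : Matrix ι ι ℝ) : Matrix ι ι ℝ →ₗ[ℝ] ℝ where
  toFun := matInner M
  map_add' := by simp [matInner, mul_add]
  map_smul' := by simp [matInner]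

theorem matInnerₗ_apply (M N : Matrix ι ι ℝ) : matInnerₗ M N = matInner M N := rfl

theorem matInner_eq_sum (M N : Matrix ι ι ℝ) : matInner M N = ∑ i, ∑ j, M i j * N i j := by
  rw [Finset.sum_comm]
  simp [matInner, trace, mul_apply]

theorem matInner_comm (M N : Matrix ι ι ℝ) : matInner M N = matInner N M := by
  simp [matInner_eq_sum, mul_comm]

theorem matInner_vecMulVec_self (M : Matrix ι ι ℝ) (v : ι → ℝ) :
    matInner M (vecMulVec v v) = v ⬝ᵥ (M *ᵥ v) := by
  simp only [matInner_eq_sum, dotProduct, mulVec, vecMulVec_apply, Finset.mul_sum]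
  refine Finset.sum_congr rfl fun i _ => Finset.sum_congr rfl fun j _ => by ring

theorem matInner_sum_vecMulVec {κ : Type*} (s : Finset κ) (M : Matrix ι ι ℝ) (v : κ → ι → ℝ) :
    matInner M (∑ k ∈ s, vecMulVec (v k) (v k)) = ∑ k ∈ s, v k ⬝ᵥ (M *ᵥ v k) := by
  rw [← matInnerₗ_apply, map_sum]
  simp [matInnerₗ_apply, matInner_vecMulVec_self]

theorem matInner_nonneg_of_mem_copositiveCone {M X : Matrix ι ι ℝ}
    (hM : M ∈ copositiveCone ι) (hX : X ∈ completelyPositiveCone ι) : 0 ≤ matInner M X := by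
  obtain ⟨K, v, hv, rfl⟩ := hX
  rw [matInner_sum_vecMulVec]
  exact Finset.sum_nonneg fun k _ => hM _ (hv k)

theorem matInner_sub_sum_smul {κ : Type*} [Fintype κ] (C : Matrix ι ι ℝ)
    (M : κ → Matrix ι ι ℝ) (y : κ → ℝ) (X : Matrix ι ι ℝ) :
    matInner (C - ∑ k, y k • M k) X = matInner C X - ∑ k, y k * matInner (M k) X := by
  simp only [matInner_comm _ X, ← matInnerₗ_apply]
  simp

/-- A completely positive matrix is a multiple of a convex combination of matrices `v vᵀ` with `v`
in the standard simplex. -/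
theorem exists_smul_mem_convexHull_of_mem_completelyPositiveCone [Nonempty ι]
    {X : Matrix ι ι ℝ} (hX : X ∈ completelyPositiveCone ι) :
    ∃ t : ℝ, 0 ≤ t ∧ ∃ Y ∈ convexHull ℝ ((fun v => vecMulVec v v) '' stdSimplex ℝ ι),
      X = t • Y := by
  classical
  obtain ⟨K, v, hv, rfl⟩ := hX
  set S := (fun v : ι → ℝ => vecMulVec v v) '' stdSimplex ℝ ι
  have hne : ∃ Y, Y ∈ convexHull ℝ S := by
    obtain ⟨i⟩ := ‹Nonempty ι›
    exact ⟨_, subset_convexHull ℝ S ⟨_, single_mem_stdSimplex ℝ i, rfl⟩⟩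
  refine Finset.sum_induction _ (fun X => ∃ t : ℝ, 0 ≤ t ∧ ∃ Y ∈ convexHull ℝ S, X = t • Y)
    ?_ ?_ fun k _ => ?_
  · rintro _ _ ⟨a, ha, Y, hY, rfl⟩ ⟨b, hb, Z, hZ, rfl⟩
    rcases (add_nonneg ha hb).eq_or_lt' with h | h
    · obtain ⟨rfl, rfl⟩ := (add_eq_zero_iff_of_nonneg ha hb).1 h
      exact ⟨0, le_rfl, Y, hY, by simp⟩
    · refine ⟨a + b, h.le, _, convex_iff_div.1 (convex_convexHull ℝ S) hY hZ ha hb h, ?_⟩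
      simp only [smul_add, smul_smul, mul_div_cancel₀ _ h.ne']
  · obtain ⟨Y, hY⟩ := hne
    exact ⟨0, le_rfl, Y, hY, by simp⟩
  · have hs : 0 ≤ ∑ i, v k i := Finset.sum_nonneg fun i _ => hv k i
    rcases hs.eq_or_lt' with h | h
    · have hz : v k = 0 := by
        funext i
        exact (Finset.sum_eq_zero_iff_of_nonneg fun i _ => hv k i).1 h i (Finset.mem_univ i)
      obtain ⟨Y, hY⟩ := hne
      exact ⟨0, le_rfl, Y, hY, by simp [hz]⟩
    · refine ⟨(∑ i, v k i) ^ 2, by positivity, _, subset_convexHull ℝ S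
        ⟨(∑ i, v k i)⁻¹ • v k, ⟨fun i => mul_nonneg (by positivity) (hv k i), ?_⟩, rfl⟩, ?_⟩
      · simp [← Finset.mul_sum, h.ne']
      · simp only [vecMulVec_smul, smul_vecMulVec, smul_smul]
        field_simp
        simp

/-- A linear image of the completely positive cone is closed if the map has trivial kernel on the
cone. -/
theorem isClosed_image_completelyPositiveCone [Nonempty ι] {E : Type*} [NormedAddCommGroup E]
    [NormedSpace ℝ E] [FiniteDimensional ℝ E] (T : Matrix ι ι ℝ →ₗ[ℝ] E)
    (hT : ∀ X ∈ completelyPositiveCone ι, T X = 0 → X = 0) :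
    IsClosed (T '' completelyPositiveCone ι) := by
  classical
  set S := (fun v : ι → ℝ => vecMulVec v v) '' stdSimplex ℝ ι
  have hsub : convexHull ℝ S ⊆ completelyPositiveCone ι := by
    refine convexHull_min ?_ convex_completelyPositiveCone
    rintro _ ⟨v, hv, rfl⟩
    exact vecMulVec_self_mem_completelyPositiveCone hv.1
  -- The sum of entries is 1 on the hull, so the hull avoids 0; by `hT` its image does too.
  have hsum : ∀ X ∈ convexHull ℝ S, matInner (of fun _ _ => 1) X = 1 := by
    refine convexHull_min ?_ ((convex_singleton (1 : ℝ)).linear_preimage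
      (matInnerₗ (of fun _ _ => 1)))
    rintro _ ⟨v, hv, rfl⟩
    have : ∑ i, v i = 1 := hv.2
    change matInner (of fun _ _ => 1) (vecMulVec v v) = 1
    simp [matInner_eq_sum, vecMulVec_apply, ← Finset.mul_sum, this]
  have hcomp : IsCompact (T '' convexHull ℝ S) := by
    rw [T.image_convexHull]
    refine isCompact_convexHull_of_isCompact ?_
    refine IsCompact.image (IsCompact.image (isCompact_stdSimplex ℝ ι) ?_)
      T.continuous_of_finiteDimensional
    exact continuous_id.matrix_vecMulVec continuous_id
  convert isClosed_nonneg_smul hcomp ?_ using 1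
  · ext e
    constructor
    · rintro ⟨X, hX, rfl⟩
      obtain ⟨t, ht, Y, hY, rfl⟩ := exists_smul_mem_convexHull_of_mem_completelyPositiveCone hX
      exact ⟨t, ht, T Y, ⟨Y, hY, rfl⟩, by simp⟩
    · rintro ⟨t, ht, _, ⟨Y, hY, rfl⟩, rfl⟩
      exact ⟨t • Y, smul_mem_completelyPositiveCone ht (hsub hY), by simp⟩
  · rintro ⟨X, hX, h0⟩
    have h1 := hsum X hX
    rw [hT X (hsub hX) h0] at h1
    simp [matInner] at h1

/-- Strong duality for linear programs over the completely positive cone whose constraints have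
no nonzero recession direction. -/
theorem completelyPositive_strong_duality [Nonempty ι] {κ : Type*} [Fintype κ]
    (C : Matrix ι ι ℝ) (M : κ → Matrix ι ι ℝ) (r : κ → ℝ)
    (hrec : ∀ X ∈ completelyPositiveCone ι, (∀ k, matInner (M k) X = 0) → X = 0)
    (hfeas : ∃ X ∈ completelyPositiveCone ι, ∀ k, matInner (M k) X = r k) :
    ∃ v : ℝ,
      IsLeast (matInner C '' {X | X ∈ completelyPositiveCone ι ∧
        ∀ k, matInner (M k) X = r k}) v ∧
      IsLUB ((fun y : κ → ℝ => ∑ k, y k * r k) ''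
        {y | C - ∑ k, y k • M k ∈ copositiveCone ι}) v := by
  classical
  let T : Matrix ι ι ℝ →ₗ[ℝ] (κ → ℝ) × ℝ :=
    (LinearMap.pi fun k => matInnerₗ (M k)).prod (matInnerₗ C)
  set W := T '' completelyPositiveCone ι
  have hclosed : IsClosed W := isClosed_image_completelyPositiveCone T fun X hX h =>
    hrec X hX fun k => congrFun (congrArg Prod.fst h) k
  have hconv : Convex ℝ W := convex_completelyPositiveCone.linear_image T
  have hsmul : ∀ t : ℝ, 0 ≤ t → ∀ w ∈ W, t • w ∈ W := by
    rintro t ht _ ⟨X, hX, rfl⟩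
    exact ⟨t • X, smul_mem_completelyPositiveCone ht hX, by simp⟩
  set V := matInner C '' {X | X ∈ completelyPositiveCone ι ∧ ∀ k, matInner (M k) X = r k}
  have hV : ∀ s, s ∈ V ↔ (r, s) ∈ W := by
    intro s
    constructor
    · rintro ⟨X, ⟨hX, hr⟩, rfl⟩
      exact ⟨X, hX, Prod.ext (funext hr) rfl⟩
    · rintro ⟨X, hX, h⟩
      exact ⟨X, ⟨hX, congrFun (congrArg Prod.fst h)⟩, congrArg Prod.snd h⟩
  have hVne : V.Nonempty := by
    obtain ⟨X, hX⟩ := hfeas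
    exact ⟨_, X, hX, rfl⟩
  have hVclosed : IsClosed V := by
    have : V = (fun s => (r, s)) ⁻¹' W := Set.ext hV
    rw [this]
    exact hclosed.preimage (by fun_prop)
  have weak : ∀ y : κ → ℝ, C - ∑ k, y k • M k ∈ copositiveCone ι → ∀ s ∈ V,
      ∑ k, y k * r k ≤ s := by
    rintro y hy _ ⟨X, ⟨hX, hr⟩, rfl⟩
    have := matInner_nonneg_of_mem_copositiveCone hy hX
    rw [matInner_sub_sum_smul] at this
    simp only [hr] at this
    linarith
  -- a value strictly below a primal value but not attained is exceeded by a dual feasible point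
  have strong : ∀ s, s ∉ V → (∃ s' ∈ V, s < s') →
      ∃ y : κ → ℝ, C - ∑ k, y k • M k ∈ copositiveCone ι ∧ s < ∑ k, y k * r k := by
    rintro s hs ⟨s', hs', hlt⟩
    obtain ⟨f, u, hf, hu⟩ := geometric_hahn_banach_closed_point hconv hclosed
      (fun h => hs ((hV s).2 h))
    have hu0 : 0 < u := by
      have := hf 0 ⟨0, zero_mem_completelyPositiveCone, map_zero T⟩
      simpa using this
    -- On a cone, a positive value of `f` could be rescaled to equal `u`.
    have hneg : ∀ w ∈ W, f w ≤ 0 := by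
      intro w hw
      by_contra! h
      have := hf _ (hsmul (u / f w) (by positivity) w hw)
      rw [map_smul, smul_eq_mul, div_mul_cancel₀ _ h.ne'] at this
      exact this.false
    have hrep : ∀ (a : κ → ℝ) (x : ℝ),
        f (a, x) = ∑ k, a k * f (Pi.single k 1, 0) + x * f (0, 1) := by
      intro a x
      have h1 : (a, x) = ∑ k, a k • ((Pi.single k 1 : κ → ℝ), (0 : ℝ)) +
          x • ((0 : κ → ℝ), (1 : ℝ)) := by
        ext k
        · simp [Prod.fst_sum, Finset.sum_apply, Pi.single_apply]
        · simp [Prod.snd_sum]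
      rw [h1]
      simp only [map_add, map_sum, map_smul, smul_eq_mul]
    have h2 := hneg _ ((hV s').1 hs')
    have h3 := hu0.trans hu
    set q := f (0, 1)
    rw [hrep] at h2 h3
    -- Subtracting `h3` from `h2` gives `(s' - s) * q < 0`. Dividing the separating functional by
    -- `-q` normalises the cost coefficient and leaves the dual multipliers.
    have hq : q < 0 := by nlinarith
    refine ⟨fun k => -(f (Pi.single k 1, 0) / q), fun v hv => ?_, ?_⟩
    · have h4 := hneg _ ⟨_, vecMulVec_self_mem_completelyPositiveCone hv, rfl⟩
      rw [← matInner_vecMulVec_self, matInner_sub_sum_smul]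
      change f (fun k => matInner (M k) (vecMulVec v v), matInner C (vecMulVec v v)) ≤ 0 at h4
      rw [hrep] at h4
      have h5 : ∑ k, -(f (Pi.single k 1, 0) / q) * matInner (M k) (vecMulVec v v) =
          -(∑ k, matInner (M k) (vecMulVec v v) * f (Pi.single k 1, 0)) / q := by
        rw [← Finset.sum_neg_distrib, Finset.sum_div]
        exact Finset.sum_congr rfl fun k _ => by ring
      rw [h5, sub_nonneg, div_le_iff_of_neg hq]
      linarith
    · have h5 : ∑ k, -(f (Pi.single k 1, 0) / q) * r k =
          -(∑ k, r k * f (Pi.single k 1, 0)) / q := by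
        rw [← Finset.sum_neg_distrib, Finset.sum_div]
        exact Finset.sum_congr rfl fun k _ => by ring
      change s < ∑ k, -(f (Pi.single k 1, 0) / q) * r k
      rw [h5, lt_div_iff_of_neg hq]
      linarith
  have hbdd : BddBelow V := by
    by_contra hnb
    obtain ⟨X₀, hX₀, hX₀r⟩ := hfeas
    -- rescaling values tending to `-∞` shows that `(0, -1)` belongs to the closed cone `W`
    have key : ((0 : κ → ℝ), (-1 : ℝ)) ∈ W := by
      have hn : ∀ n : ℕ, ∃ s ∈ V, s < -(n + 1 : ℝ) := by
        intro n
        by_contra! h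
        exact hnb ⟨_, h⟩
      choose s hsV hs using hn
      have hs0 : ∀ n, s n < 0 := fun n => (hs n).trans (by linarith [(n.cast_nonneg : (0 : ℝ) ≤ n)])
      have hlim : Filter.Tendsto (fun n => (-s n)⁻¹) Filter.atTop (nhds 0) := by
        refine Filter.Tendsto.inv_tendsto_atTop (Filter.tendsto_atTop_mono (fun n => ?_)
          tendsto_natCast_atTop_atTop)
        linarith [hs n]
      refine hclosed.mem_of_tendsto (f := fun n => (-s n)⁻¹ • (r, s n)) (b := Filter.atTop) ?_
        (Filter.Eventually.of_forall fun n => hsmul _ (by simpa using (hs0 n).le) _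
          ((hV _).1 (hsV n)))
      simp only [Prod.smul_mk, smul_eq_mul]
      refine Filter.Tendsto.prodMk_nhds (by simpa using hlim.smul_const r) ?_
      refine tendsto_const_nhds.congr fun n => ?_
      field_simp [(hs0 n).ne]
    obtain ⟨X, hX, h⟩ := key
    have hX0 := hrec X hX fun k => congrFun (congrArg Prod.fst h) k
    have h1 : matInner C X = -1 := congrArg Prod.snd h
    simp [hX0, matInner] at h1
  have hmin : IsLeast V (sInf V) := hVclosed.isLeast_csInf hVne hbdd
  refine ⟨sInf V, hmin, ?_, fun w hw => ?_⟩
  · rintro _ ⟨y, hy, rfl⟩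
    exact weak y hy _ hmin.1
  · by_contra! hlt
    obtain ⟨y, hy, hy'⟩ := strong w (fun h => (hmin.2 h).not_gt hlt) ⟨_, hmin.1, hlt⟩
    exact (hw ⟨y, hy, rfl⟩).not_gt hy'

end Cone

/-! ### Bordered matrices and their quadratic forms. -/

theorem dotProduct_borderedMatrix_mulVec {n : ℕ} (S : Matrix (Fin n) (Fin n) ℝ) (u : Fin n → ℝ)
    (d : ℝ) (v : Fin n ⊕ Unit → ℝ) :
    v ⬝ᵥ (borderedMatrix S u d *ᵥ v) =
      (v ∘ Sum.inl) ⬝ᵥ (S *ᵥ (v ∘ Sum.inl)) + 2 * v (Sum.inr ()) * (u ⬝ᵥ (v ∘ Sum.inl)) +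
        d * v (Sum.inr ()) ^ 2 := by
  have h : (v ∘ Sum.inl) ⬝ᵥ (of (fun i (_ : Unit) => u i) *ᵥ (v ∘ Sum.inr)) =
      v (Sum.inr ()) * (u ⬝ᵥ (v ∘ Sum.inl)) := by
    simp only [dotProduct, mulVec, Finset.mul_sum, Finset.univ_unique, Finset.sum_singleton,
      of_apply, Function.comp_apply]
    exact Finset.sum_congr rfl fun i _ => by
      change _ * (_ * v (Sum.inr ())) = _
      ring
  have h' : (v ∘ Sum.inr) ⬝ᵥ (of (fun (_ : Unit) j => u j) *ᵥ (v ∘ Sum.inl)) =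
      v (Sum.inr ()) * (u ⬝ᵥ (v ∘ Sum.inl)) := by
    simp [dotProduct, mulVec]
  have h'' : (v ∘ Sum.inr) ⬝ᵥ (of (fun (_ _ : Unit) => d) *ᵥ (v ∘ Sum.inr)) =
      d * v (Sum.inr ()) ^ 2 := by
    simp [dotProduct, mulVec]
    ring
  have hv : v = Sum.elim (v ∘ Sum.inl) (v ∘ Sum.inr) := by
    ext (i | i) <;> rfl
  rw [borderedMatrix, fromBlocks_mulVec]
  nth_rw 1 [hv]
  rw [sumElim_dotProduct_sumElim, dotProduct_add, dotProduct_add, h, h', h'']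
  ring

/-- Symmetry makes the two off-diagonal blocks agree, so every matrix of the cone can be read as
`[X, x, d]`. -/
theorem eq_borderedMatrix_of_mem_completelyPositiveCone {n : ℕ}
    {Y : Matrix (Fin n ⊕ Unit) (Fin n ⊕ Unit) ℝ}
    (hY : Y ∈ completelyPositiveCone (Fin n ⊕ Unit)) :
    Y = borderedMatrix Y.toBlocks₁₁ (fun i => Y (Sum.inl i) (Sum.inr ()))
      (Y (Sum.inr ()) (Sum.inr ())) := by
  obtain ⟨K, v, -, rfl⟩ := hY
  ext (i | i) (j | j)
  · rfl
  · rfl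
  · simp [borderedMatrix, Matrix.sum_apply, vecMulVec_apply, mul_comm]
  · rfl

theorem matInner_borderedMatrix_zero_zero_one {n : ℕ}
    (Y : Matrix (Fin n ⊕ Unit) (Fin n ⊕ Unit) ℝ) :
    matInner (borderedMatrix 0 0 1) Y = Y (Sum.inr ()) (Sum.inr ()) := by
  simp [matInner_eq_sum, borderedMatrix, Fintype.sum_sum_type]

theorem borderedMatrix_vecMulVec_self {n : ℕ} (x : Fin n → ℝ) :
    borderedMatrix (vecMulVec x x) x 1 =
      vecMulVec (Sum.elim x fun _ => 1) (Sum.elim x fun _ => 1) := by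
  ext (i | i) (j | j) <;> simp [borderedMatrix, vecMulVec_apply]

/-! ### Burer's program: conic form, recession directions, exactness. -/

namespace MBQP

variable {n m : ℕ} (P : MBQP n m)

theorem linMatrix_quadForm (i : Fin m) (v : Fin n ⊕ Unit → ℝ) :
    v ⬝ᵥ (P.linMatrix i *ᵥ v) = v (Sum.inr ()) * (P.A *ᵥ (v ∘ Sum.inl)) i := by
  rw [linMatrix, dotProduct_borderedMatrix_mulVec, smul_dotProduct]
  simp [mulVec]
  ring

theorem quadMatrix_quadForm (i : Fin m) (v : Fin n ⊕ Unit → ℝ) :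
    v ⬝ᵥ (P.quadMatrix i *ᵥ v) = (P.A *ᵥ (v ∘ Sum.inl)) i ^ 2 := by
  rw [quadMatrix, dotProduct_borderedMatrix_mulVec, vecMulVec_mulVec]
  simp [mulVec, dotProduct_comm]
  ring

theorem binMatrix_quadForm (j : Fin n) (v : Fin n ⊕ Unit → ℝ) :
    v ⬝ᵥ (binMatrix j *ᵥ v) = v (Sum.inl j) * (v (Sum.inr ()) - v (Sum.inl j)) := by
  rw [binMatrix, dotProduct_borderedMatrix_mulVec, neg_mulVec, vecMulVec_mulVec]
  simp
  ring

theorem costMatrix_quadForm (v : Fin n ⊕ Unit → ℝ) :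
    v ⬝ᵥ (P.costMatrix *ᵥ v) = (v ∘ Sum.inl) ⬝ᵥ (P.Q *ᵥ (v ∘ Sum.inl)) +
      2 * v (Sum.inr ()) * (P.c ⬝ᵥ (v ∘ Sum.inl)) := by
  rw [costMatrix, dotProduct_borderedMatrix_mulVec]
  ring

/-- The constraint matrices of the completely positive program, including the one that fixes the
lower right corner. -/
noncomputable def constraintMatrix :
    Unit ⊕ Fin m ⊕ Fin m ⊕ P.B → Matrix (Fin n ⊕ Unit) (Fin n ⊕ Unit) ℝ :=
  Sum.elim (fun _ => borderedMatrix 0 0 1)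
    (Sum.elim P.linMatrix (Sum.elim P.quadMatrix fun j => binMatrix (j : Fin n)))

/-- The right-hand sides of the completely positive program. -/
def constraintRhs : Unit ⊕ Fin m ⊕ Fin m ⊕ P.B → ℝ :=
  Sum.elim (fun _ => 1) (Sum.elim P.b (Sum.elim (fun i => P.b i ^ 2) fun _ => 0))

theorem cppObjective_image_cppFeasible :
    P.cppObjective '' P.cppFeasible = matInner P.costMatrix ''
      {Y | Y ∈ completelyPositiveCone (Fin n ⊕ Unit) ∧
        ∀ k, matInner (P.constraintMatrix k) Y = P.constraintRhs k} := by
  ext s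
  constructor
  · rintro ⟨p, ⟨h1, h2, h3, h4⟩, rfl⟩
    refine ⟨_, ⟨h4, ?_⟩, rfl⟩
    rintro (_ | i | i | j)
    · exact matInner_borderedMatrix_zero_zero_one _
    · exact h1 i
    · exact h2 i
    · exact h3 j j.2
  · rintro ⟨Y, ⟨hY, h⟩, rfl⟩
    have h1 : Y (Sum.inr ()) (Sum.inr ()) = 1 :=
      (matInner_borderedMatrix_zero_zero_one Y).symm.trans (h (Sum.inl ()))
    have hb := eq_borderedMatrix_of_mem_completelyPositiveCone hY
    rw [h1] at hb
    refine ⟨(Y.toBlocks₁₁, fun i => Y (Sum.inl i) (Sum.inr ())), ?_, ?_⟩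
    · simp only [cppFeasible, Set.mem_ofPred_eq, ← hb]
      exact ⟨fun i => h (Sum.inr (Sum.inl i)), fun i => h (Sum.inr (Sum.inr (Sum.inl i))),
        fun j hj => h (Sum.inr (Sum.inr (Sum.inr ⟨j, hj⟩))), hY⟩
    · simp only [cppObjective, ← hb]

/-- `γ` is the multiplier of the constraint fixing the corner entry to 1. -/
theorem copObjective_image_copFeasible :
    P.copObjective '' P.copFeasible =
      (fun y : Unit ⊕ Fin m ⊕ Fin m ⊕ P.B → ℝ => ∑ k, y k * P.constraintRhs k) ''
        {y | P.costMatrix - ∑ k, y k • P.constraintMatrix k ∈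
          copositiveCone (Fin n ⊕ Unit)} := by
  have hM : ∀ y : P.DualVar, P.dualMatrix y = P.costMatrix -
      ∑ k, Sum.elim (fun _ => y.γ) (Sum.elim y.μlin (Sum.elim y.μquad y.lam)) k •
        P.constraintMatrix k := by
    intro y
    simp only [dualMatrix, constraintMatrix, Fintype.sum_sum_type, Sum.elim_inl, Sum.elim_inr,
      Finset.univ_unique, Finset.sum_singleton]
    abel
  have hO : ∀ y : P.DualVar, P.copObjective y =
      ∑ k, Sum.elim (fun _ => y.γ) (Sum.elim y.μlin (Sum.elim y.μquad y.lam)) k *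
        P.constraintRhs k := by
    intro y
    simp only [copObjective, constraintRhs, Fintype.sum_sum_type, Sum.elim_inl, Sum.elim_inr,
      Finset.univ_unique, Finset.sum_singleton, Finset.sum_add_distrib, mul_one, mul_zero,
      Finset.sum_const_zero, add_zero]
  ext s
  constructor
  · rintro ⟨y, hy, rfl⟩
    refine ⟨_, ?_, (hO y).symm⟩
    rw [Set.mem_ofPred_eq, ← hM]
    exact hy
  · rintro ⟨y, hy, rfl⟩
    let z : P.DualVar := ⟨fun i => y (Sum.inr (Sum.inl i)),
      fun i => y (Sum.inr (Sum.inr (Sum.inl i))), fun j => y (Sum.inr (Sum.inr (Sum.inr j))),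
      y (Sum.inl ())⟩
    have hz : Sum.elim (fun _ => z.γ) (Sum.elim z.μlin (Sum.elim z.μquad z.lam)) = y := by
      ext (_ | i | i | j) <;> rfl
    refine ⟨z, ?_, (hO z).trans (by rw [hz])⟩
    change P.dualMatrix z ∈ copositiveCone _
    rw [hM, hz]
    exact hy

variable {P}

/-- A nonzero recession direction of the feasible region would make it unbounded. -/
theorem eq_zero_of_recession (hfeas : P.feasibleRegion.Nonempty)
    (hbdd : Bornology.IsBounded P.feasibleRegion) {z : Fin n → ℝ} (hz : ∀ i, 0 ≤ z i)
    (hA : P.A *ᵥ z = 0) (hB : ∀ j ∈ P.B, z j = 0) : z = 0 := by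
  obtain ⟨x, hxA, hx0, hxB⟩ := hfeas
  obtain ⟨R, hR⟩ := hbdd.exists_norm_le
  ext i
  by_contra hne
  have hi : 0 < z i := lt_of_le_of_ne (hz i) (Ne.symm hne)
  -- With this step length, coordinate `i` reaches at least `|R| + 1`, beyond the norm bound `R`.
  have ht : 0 ≤ (|R| + 1) / z i := by positivity
  have hmem : x + ((|R| + 1) / z i) • z ∈ P.feasibleRegion := by
    refine ⟨?_, fun k => add_nonneg (hx0 k) (mul_nonneg ht (hz k)), fun j hj => ?_⟩
    · rw [mulVec_add, mulVec_smul, hA, hxA, smul_zero, add_zero]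
    · simpa [hB j hj] using hxB j hj
  have h1 := (norm_le_pi_norm _ i).trans (hR _ hmem)
  have h2 := (le_abs_self _).trans h1
  simp only [Pi.add_apply, Pi.smul_apply, smul_eq_mul, div_mul_cancel₀ _ hi.ne'] at h2
  linarith [hx0 i, le_abs_self R]

theorem lift_mem_cppFeasible {x : Fin n → ℝ} (hx : x ∈ P.feasibleRegion) :
    (vecMulVec x x, x) ∈ P.cppFeasible := by
  obtain ⟨hA, h0, hB⟩ := hx
  have hl : (Sum.elim x fun _ : Unit => (1 : ℝ)) ∘ Sum.inl = x := rfl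
  simp only [cppFeasible, Set.mem_ofPred_eq, borderedMatrix_vecMulVec_self,
    matInner_vecMulVec_self, linMatrix_quadForm, quadMatrix_quadForm, binMatrix_quadForm, hl, hA]
  refine ⟨by simp, by simp, fun j hj => ?_, vecMulVec_self_mem_completelyPositiveCone ?_⟩
  · rcases hB j hj with h | h <;> simp [h]
  · rintro (i | i)
    · exact h0 i
    · exact zero_le_one

theorem cppObjective_lift (x : Fin n → ℝ) : P.cppObjective (vecMulVec x x, x) = P.objective x := by
  have hl : (Sum.elim x fun _ : Unit => (1 : ℝ)) ∘ Sum.inl = x := rfl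
  simp [cppObjective, borderedMatrix_vecMulVec_self, matInner_vecMulVec_self, costMatrix_quadForm,
    objective, hl]

theorem eq_zero_of_matInner_constraintMatrix_eq_zero (hfeas : P.feasibleRegion.Nonempty)
    (hbdd : Bornology.IsBounded P.feasibleRegion)
    {Y : Matrix (Fin n ⊕ Unit) (Fin n ⊕ Unit) ℝ}
    (hY : Y ∈ completelyPositiveCone (Fin n ⊕ Unit))
    (h : ∀ k, matInner (P.constraintMatrix k) Y = 0) : Y = 0 := by
  obtain ⟨K, v, hv, rfl⟩ := hY
  have h0 : ∀ k, v k (Sum.inr ()) = 0 := by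
    have h1 := h (Sum.inl ())
    rw [constraintMatrix, Sum.elim_inl, matInner_sum_vecMulVec] at h1
    simp only [dotProduct_borderedMatrix_mulVec, zero_mulVec, dotProduct_zero, zero_dotProduct,
      mul_zero, zero_add, one_mul] at h1
    intro k
    exact pow_eq_zero_iff two_ne_zero |>.1
      ((Finset.sum_eq_zero_iff_of_nonneg fun k _ => sq_nonneg _).1 h1 k (Finset.mem_univ k))
  refine Finset.sum_eq_zero fun k _ => ?_
  have hz : v k ∘ Sum.inl = 0 := by
    refine eq_zero_of_recession hfeas hbdd (fun i => hv k _) (funext fun i => ?_) fun j hj => ?_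
    · have h1 := h (Sum.inr (Sum.inr (Sum.inl i)))
      simp only [constraintMatrix, Sum.elim_inl, Sum.elim_inr, matInner_sum_vecMulVec,
        quadMatrix_quadForm] at h1
      exact pow_eq_zero_iff two_ne_zero |>.1
        ((Finset.sum_eq_zero_iff_of_nonneg fun k _ => sq_nonneg _).1 h1 k (Finset.mem_univ k))
    · have h1 := h (Sum.inr (Sum.inr (Sum.inr ⟨j, hj⟩)))
      simp only [constraintMatrix, Sum.elim_inr, matInner_sum_vecMulVec,
        binMatrix_quadForm, h0, zero_sub, mul_neg, Finset.sum_neg_distrib, neg_eq_zero] at h1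
      exact mul_self_eq_zero.1 ((Finset.sum_eq_zero_iff_of_nonneg fun k _ =>
        mul_self_nonneg _).1 h1 k (Finset.mem_univ k))
  have hvk : v k = 0 := by
    ext (i | i)
    · exact congrFun hz i
    · exact h0 k
  simp [hvk]

/-- Burer's reformulation is exact: every feasible point of the completely positive program is
dominated by a feasible point of the mixed-binary program. -/
theorem exists_objective_le_cppObjective (hfeas : P.feasibleRegion.Nonempty)
    (hbdd : Bornology.IsBounded P.feasibleRegion)
    (hkey : ∀ x ∈ P.polyhedron, ∀ j ∈ P.B, x j ≤ 1)
    {p : Matrix (Fin n) (Fin n) ℝ × (Fin n → ℝ)} (hp : p ∈ P.cppFeasible) :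
    ∃ x ∈ P.feasibleRegion, P.objective x ≤ P.cppObjective p := by
  obtain ⟨hlin, hquad, hbin, K, v, hv, hY⟩ := hp
  have hone := matInner_borderedMatrix_zero_zero_one (borderedMatrix p.1 p.2 1)
  rw [cppObjective]
  simp only [hY, matInner_sum_vecMulVec, linMatrix_quadForm, quadMatrix_quadForm,
    binMatrix_quadForm] at hlin hquad hbin hone ⊢
  set ξ : Fin K → ℝ := fun k => v k (Sum.inr ())
  set z : Fin K → Fin n → ℝ := fun k => v k ∘ Sum.inl
  have hz0 : ∀ k i, 0 ≤ z k i := fun k i => hv k _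
  have hsum : ∑ k, ξ k ^ 2 = 1 := by
    rw [← hY] at hone
    simp only [dotProduct_borderedMatrix_mulVec, zero_mulVec, dotProduct_zero, zero_dotProduct,
      mul_zero, zero_add, one_mul] at hone
    exact hone
  have hA : ∀ k, P.A *ᵥ z k = ξ k • P.b := by
    intro k
    ext i
    -- Expanding the square turns the sum into `b² - 2b·b + b²` by the squared, linear and corner
    -- constraints.
    have h1 : ∑ k, ((P.A *ᵥ z k) i - ξ k * P.b i) ^ 2 = 0 := by
      have : ∀ k, ((P.A *ᵥ z k) i - ξ k * P.b i) ^ 2 = (P.A *ᵥ z k) i ^ 2 -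
          2 * P.b i * (ξ k * (P.A *ᵥ z k) i) + P.b i ^ 2 * ξ k ^ 2 := fun k => by ring
      simp only [this, Finset.sum_add_distrib, Finset.sum_sub_distrib, ← Finset.mul_sum]
      rw [hsum, hquad i, hlin i]
      ring
    have h2 := (Finset.sum_eq_zero_iff_of_nonneg fun k _ => sq_nonneg _).1 h1 k (Finset.mem_univ k)
    exact sub_eq_zero.1 (pow_eq_zero_iff two_ne_zero |>.1 h2)
  -- For `ξ k > 0`, apply `hkey` to `z k / ξ k`. For `ξ k = 0`, `z k` is a recession direction of
  -- the polyhedron, and moving by `2 / z k j` would push coordinate `j` to at least 2.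
  have hle : ∀ k, ∀ j ∈ P.B, z k j ≤ ξ k := by
    intro k j hj
    rcases (hv k (Sum.inr ())).eq_or_lt' with h | h
    · have hξk : ξ k = 0 := h
      by_contra! hlt
      rw [hξk] at hlt
      obtain ⟨x, hxA, hx0, hxB⟩ := hfeas
      have := hkey (x + (2 / z k j) • z k) ⟨?_, fun i =>
        add_nonneg (hx0 i) (mul_nonneg (by positivity) (hz0 k i))⟩ j hj
      · simp only [Pi.add_apply, Pi.smul_apply, smul_eq_mul, div_mul_cancel₀ _ hlt.ne'] at this
        linarith [hx0 j]
      · rw [mulVec_add, mulVec_smul, hA, hxA, hξk]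
        simp
    · have h' : 0 < ξ k := h
      have := hkey ((ξ k)⁻¹ • z k) ⟨?_, fun i => mul_nonneg (by positivity) (hz0 k i)⟩ j hj
      · simpa [inv_mul_le_iff₀ h'] using this
      · rw [mulVec_smul, hA, smul_smul, inv_mul_cancel₀ h'.ne', one_smul]
  -- By `hle` the terms `z j * (ξ - z j)` are nonnegative; their sum is zero, so each vanishes.
  have hbin' : ∀ k, ∀ j ∈ P.B, z k j = 0 ∨ z k j = ξ k := by
    intro k j hj
    have := (Finset.sum_eq_zero_iff_of_nonneg fun k _ =>
      mul_nonneg (hz0 k j) (sub_nonneg.2 (hle k j hj))).1 (hbin j hj) k (Finset.mem_univ k)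
    exact (mul_eq_zero.1 this).imp_right fun h => (sub_eq_zero.1 h).symm
  have hmem : ∀ k, 0 < ξ k → (ξ k)⁻¹ • z k ∈ P.feasibleRegion := by
    intro k h
    refine ⟨?_, fun i => mul_nonneg (by positivity) (hz0 k i), fun j hj => ?_⟩
    · rw [mulVec_smul, hA, smul_smul, inv_mul_cancel₀ h.ne', one_smul]
    · refine (hbin' k j hj).imp (fun h' => ?_) fun h' => ?_
      · simp [h']
      · simp [h', h.ne']
  have hzero : ∀ k, ξ k = 0 → z k = 0 := fun k h =>
    eq_zero_of_recession hfeas hbdd (hz0 k) (by rw [hA, h, zero_smul])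
      fun j hj => (hbin' k j hj).elim id fun h' => h'.trans h
  by_contra! hlt
  set s := ∑ k, v k ⬝ᵥ (P.costMatrix *ᵥ v k)
  -- The cost form at `v k` is `ξ k ^ 2` times the objective at `z k / ξ k`, and is zero when `ξ k =
  -- 0`. As the weights sum to 1, not all objectives can exceed `s`.
  have hterm : ∀ k, ξ k ^ 2 * s ≤ v k ⬝ᵥ (P.costMatrix *ᵥ v k) ∧
      (0 < ξ k → ξ k ^ 2 * s < v k ⬝ᵥ (P.costMatrix *ᵥ v k)) := by
    intro k
    rw [costMatrix_quadForm]
    change ξ k ^ 2 * s ≤ z k ⬝ᵥ (P.Q *ᵥ z k) + 2 * ξ k * (P.c ⬝ᵥ z k) ∧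
      (0 < ξ k → ξ k ^ 2 * s < z k ⬝ᵥ (P.Q *ᵥ z k) + 2 * ξ k * (P.c ⬝ᵥ z k))
    have hpos : 0 < ξ k → ξ k ^ 2 * s < z k ⬝ᵥ (P.Q *ᵥ z k) + 2 * ξ k * (P.c ⬝ᵥ z k) := by
      intro h
      have h1 := mul_lt_mul_of_pos_left (hlt _ (hmem k h)) (pow_pos h 2)
      refine h1.trans_eq ?_
      simp only [objective, mulVec_smul, dotProduct_smul, smul_dotProduct, smul_eq_mul]
      field_simp
    refine ⟨?_, hpos⟩
    rcases (hv k (Sum.inr ())).eq_or_lt' with h | h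
    · have hξk : ξ k = 0 := h
      simp [hξk, hzero k hξk]
    · exact (hpos h).le
  have hex : ∃ k, 0 < ξ k := by
    by_contra! h
    have : ∀ k, ξ k = 0 := fun k => le_antisymm (h k) (hv k _)
    simp [this] at hsum
  obtain ⟨k, hk⟩ := hex
  have h1 : ∑ k, ξ k ^ 2 * s < s :=
    Finset.sum_lt_sum (fun k _ => (hterm k).1) ⟨k, Finset.mem_univ k, (hterm k).2 hk⟩
  rw [← Finset.sum_mul, hsum, one_mul] at h1
  exact h1.false

end MBQP

/-- If the mixed-binary quadratic program is feasible with bounded feasible region, then the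
completely positive program attains its minimum and this minimum is the (finite) supremum of the
dual copositive program. If moreover the linear constraints imply `x j ≤ 1` for the binary
variables, this common value is the minimum of the mixed-binary quadratic program. -/
theorem theorem1 {n m : ℕ} (P : MBQP n m)
    (hfeas : P.feasibleRegion.Nonempty)
    (hbdd : Bornology.IsBounded P.feasibleRegion) :
    ∃ v : ℝ,
      IsLeast (P.cppObjective '' P.cppFeasible) v ∧
      IsLUB (P.copObjective '' P.copFeasible) v ∧
      ((∀ x ∈ P.polyhedron, ∀ j ∈ P.B, x j ≤ 1) →
        IsLeast (P.objective '' P.feasibleRegion) v) := by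
  have hlift : ∀ x ∈ P.feasibleRegion, P.objective x ∈ P.cppObjective '' P.cppFeasible :=
    fun x hx => ⟨_, MBQP.lift_mem_cppFeasible hx, MBQP.cppObjective_lift x⟩
  have hcpp : ∃ Y ∈ completelyPositiveCone (Fin n ⊕ Unit),
      ∀ k, matInner (P.constraintMatrix k) Y = P.constraintRhs k := by
    obtain ⟨x, hx⟩ := hfeas
    have := hlift x hx
    rw [P.cppObjective_image_cppFeasible] at this
    obtain ⟨Y, ⟨hY, h⟩, -⟩ := this
    exact ⟨Y, hY, h⟩
  obtain ⟨v, hmin, hsup⟩ := completelyPositive_strong_duality P.costMatrix P.constraintMatrix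
    P.constraintRhs (fun Y hY h =>
      MBQP.eq_zero_of_matInner_constraintMatrix_eq_zero hfeas hbdd hY h) hcpp
  rw [← P.cppObjective_image_cppFeasible] at hmin
  rw [← P.copObjective_image_copFeasible] at hsup
  refine ⟨v, hmin, hsup, fun hkey => ?_⟩
  have hlower : v ∈ lowerBounds (P.objective '' P.feasibleRegion) := by
    rintro _ ⟨x, hx, rfl⟩
    exact hmin.2 (hlift x hx)
  refine ⟨?_, hlower⟩
  obtain ⟨p, hp, hpv⟩ := hmin.1
  obtain ⟨x, hx, hle⟩ := MBQP.exists_objective_le_cppObjective hfeas hbdd hkey hp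
  exact ⟨x, hx, le_antisymm (hle.trans_eq hpv) (hlower ⟨x, hx, rfl⟩)⟩
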